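/- An $r$-graph on a finite set $W$ is a family $\mathcal H$ of $r$-element subsets of $W$; $|\mathcal H|$ is the number of its members (edges). Let $T$ be a tree of diameter $4$ with center $c$, let $s=\deg_T(c)$, and let $P\ni c$ and $Q$ be the two classes of the bipartition of $T$. An $(a,b)$-blowup of $T$ is a hypergraph obtained by replacing the vertices $x$ of $T$ by pairwise disjoint sets $F_x$ with $|F_x|=a$ for $x\in P$ and $|F_x|=b$ for $x\in Q$ (so the center becomes an $a$-set); its edges are the sets $F_x\cup F_y$ with $xy\in E(T)$. Theorem. Let $r\ge 3$, and let $T$ be a fixed tree of diameter $4$ whose center $c$ has degree $s$. (1) There is a constant $C=C(r,s,T)>0$ such that for all integers $a\ge 2$, $b\ge 1$ with $a+b=r$ and all $n$, every $n$-vertex $r$-graph $\mathcal H$ with $$|\mathcal H|>(s-1)\binom{n}{r-1}+Cn^{r-2}$$ contains an $(a,b)$-blowup of $T$. (2) The coefficient $s-1$ is asymptotically best possible when $s\le |V(T)|/2$: in that case, for all $a\ge 2$, $b\ge 1$ with $a+b=r$ and every $\varepsilon>0$, for all sufficiently large $n$ there is an $n$-vertex $r$-graph $\mathcal H$ with $|\mathcal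 H|\ge (s-1-\varepsilon)\binom{n}{r-1}$ that contains no $(a,b)$-blowup of $T$. (3) If moreover at most one neighbour of $c$ is a leaf of $T$, then for all $a\ge 2$, $b\ge 1$ with $a+b=r$, every $n$ and every $(s-1)$-subset $S$ of an $n$-element vertex set, the $r$-graph of all $r$-subsets of the vertex set that meet $S$ contains no $(a,b)$-blowup of $T$. -/

import Mathlib

/-- `B` is an `(a,b)`-blowup, inside the vertex set `W`, of the graph `T` with parts `P` and `Q`:
the vertices of `T` are replaced by pairwise disjoint sets, of size `a` for the vertices of `P` and
of size `b` for those of `Q`, and the members of `B` are exactly the unions of the two sets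
belonging to the ends of an edge of `T`. -/
def IsBlowup {X W : Type*} [DecidableEq W] (T : SimpleGraph X) (P Q : Set X) (a b : ℕ)
    (B : Finset (Finset W)) : Prop :=
  ∃ F : X → Finset W,
    (∀ x y, x ≠ y → Disjoint (F x) (F y)) ∧
    (∀ x ∈ P, (F x).card = a) ∧
    (∀ y ∈ Q, (F y).card = b) ∧
    ∀ e : Finset W, e ∈ B ↔ ∃ x ∈ P, ∃ y ∈ Q, T.Adj x y ∧ e = F x ∪ F y

/-- The family `H` of sets contains an `(a,b)`-blowup of the graph `T` with parts `P` and `Q`. -/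
def ContainsBlowup {X W : Type*} [DecidableEq W] (H : Finset (Finset W)) (T : SimpleGraph X)
    (P Q : Set X) (a b : ℕ) : Prop :=
  ∃ B : Finset (Finset W), B ⊆ H ∧ IsBlowup T P Q a b B

/-!
A tree of diameter four, rooted at its center `c`, has height two: one class `Q` of the bipartition
is the neighbourhood of `c`, and every vertex of `P` other than `c` hangs from one vertex of `Q`
(`SimpleGraph.IsTree.isHeightTwo`).

**Upper bound.** A set `B` is *rich* (`IsRich`) if its link contains large matchings. A blowup
exists as soon as an `a`-set `A` forms edges with `s` pairwise disjoint rich `b`-sets: the leaves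
are added greedily (`containsBlowup_of_rich`). Call a pair `(A, x)` *extendable* (`IsExtendable`)
if there are many edges `A ∪ B` with `B` rich and containing `x` that are disjoint outside
`A ∪ {x}`. Without a blowup, every `a`-set `A` has at most `s - 1` extendable vertices `x`
(`card_lt_of_isExtendable`). If each edge `e` of a family contains at least `(r - 1).choose a`
extendable pairs, then counting the triples `(e \ {x}, A, x)` shows that the family has at most
`(s - 1) * n.choose (r - 1)` edges (`card_le_of_choose_le_card_extendablePairs`).

The edges that contain fewer extendable pairs are `O(n ^ (r - 2))` in number. This is an instance of
the delta-system method of Frankl and Füredi. A large family has a nonempty subfamily in which the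
cores of large sunflowers occupy, in every edge, the same positions, and these cores cover properly
every set of `r - 2` positions (`exists_homogeneous`); otherwise the family would be determined,
up to boundedly many choices, by restrictions to `r - 2` positions. The complements of the core
positions are closed under union, and a case analysis (`choose_le_card_of_union_closed`) shows that
either some `a`-set and its complement are both cores, which gives a blowup at once, or there are
at least `(r - 1).choose a` extendable pairs (`choose_le_card_extendablePairs`).

**Lower bounds.** If all edges meet an `(s - 1)`-set `S` in exactly one vertex, then in a blowup the
vertices of `T` whose sets meet `S` form one of the classes `P` and `Q`, both of which have at least
`s` elements (`not_containsBlowup_of_card_inter_eq_one`). If at most one neighbour of `c` is a leaf,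
then `T` has a matching with `s` edges, so that no `(s - 1)`-set meets all edges of a blowup
(`not_containsBlowup_of_inter_nonempty`).
-/

/-! ### Centers of trees of diameter four -/

namespace SimpleGraph

variable {X : Type*} {T : SimpleGraph X}

/-- In a tree, every vertex has at most one neighbour closer to a given root `u`. -/
lemma IsTree.eq_of_adj_of_dist_eq (hT : T.IsTree) {u m y y' : X} (hy : T.Adj m y)
    (hy' : T.Adj m y') (h : T.dist u m = T.dist u y + 1) (h' : T.dist u m = T.dist u y' + 1) :
    y = y' := by
  classical
  obtain ⟨q, hq, -⟩ := hT.connected.exists_path_of_dist u m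
  have key : ∀ z, T.Adj m z → T.dist u m = T.dist u z + 1 → z = q.penultimate := by
    intro z hz hd
    refine hT.isAcyclic.eq_penultimate_of_adj_end hq hz ?_
    by_contra hzq
    obtain ⟨p, hp, hpl⟩ := hT.connected.exists_path_of_dist u z
    have hm := hT.isAcyclic.mem_support_of_ne_mem_support_of_adj_of_isPath hp hq hz.symm hzq
    have h1 := dist_le (p.takeUntil m hm)
    have h2 := p.length_takeUntil_le_length hm
    omega
  rw [key y hy h, key y' hy' h']

lemma Connected.exists_adj_dist_eq (hT : T.Connected) {y w : X} {k : ℕ}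
    (h : T.dist y w = k + 1) : ∃ z, T.Adj y z ∧ T.dist z w = k := by
  obtain ⟨p, hp⟩ := hT.exists_walk_length_eq_dist y w
  cases p with
  | nil => simp at h
  | cons hadj q =>
    rename_i z
    refine ⟨z, hadj, ?_⟩
    have h1 := dist_le q
    have h2 := hT.dist_triangle (u := y) (v := z) (w := w)
    rw [dist_eq_one_iff_adj.mpr hadj] at h2
    simp only [Walk.length_cons] at hp
    omega

/-- Once a geodesic of a tree moves away from `u`, it keeps moving away from `u`. -/
lemma IsTree.dist_eq_add_of_adj (hT : T.IsTree) {u w : X} :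
    ∀ (k : ℕ) {m y : X}, T.Adj m y → T.dist u y = T.dist u m + 1 →
      T.dist m w = k + 1 → T.dist y w = k → T.dist u w = T.dist u m + T.dist m w := by
  intro k
  induction k with
  | zero =>
    intro m y _ h1 h2 h3
    obtain rfl := hT.connected.dist_eq_zero_iff.mp h3
    omega
  | succ k ih =>
    intro m y hmy h1 h2 h3
    obtain ⟨z, hyz, hz⟩ := hT.connected.exists_adj_dist_eq h3
    rcases hT.dist_eq_dist_add_one_of_adj u hyz with h | h
    · have : m = z := hT.eq_of_adj_of_dist_eq hmy.symm hyz h1 h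
      subst this
      omega
    · have := ih hyz h h3 hz
      omega

/-- The middle of a longest path of a tree of diameter `4` is at distance at most `2` from every
vertex: a geodesic from it to a vertex further away would have to start towards both ends of the
longest path. -/
lemma IsTree.dist_le_two_of_mem_center [Finite X] (hT : T.IsTree) (hd : T.diam = 4) {c : X}
    (hc : c ∈ T.center) (x : X) : T.dist c x ≤ 2 := by
  have hne : T.ediam ≠ ⊤ := ediam_ne_top_of_diam_ne_zero (by omega)
  have hconn := hT.connected
  have := hconn.nonempty
  obtain ⟨u, v, huv⟩ := T.exists_dist_eq_diam
  rw [hd] at huv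
  obtain ⟨z, hz, hzv⟩ := hconn.exists_adj_dist_eq huv
  obtain ⟨m, hm, hmv⟩ := hconn.exists_adj_dist_eq hzv
  have hum : T.dist u m = 2 := by
    have h1 := hconn.dist_triangle (u := u) (v := z) (w := m)
    rw [dist_eq_one_iff_adj.mpr hz, dist_eq_one_iff_adj.mpr hm] at h1
    have h2 := hconn.dist_triangle (u := u) (v := m) (w := v)
    omega
  have hvm : T.dist v m = 2 := by rw [dist_comm, hmv]
  have hm2 : ∀ w, T.dist m w ≤ 2 := by
    intro w
    by_contra! hw
    obtain ⟨k, hk⟩ : ∃ k, T.dist m w = k + 1 := ⟨T.dist m w - 1, by omega⟩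
    obtain ⟨y, hmy, hy⟩ := hconn.exists_adj_dist_eq hk
    have key : ∀ t, T.dist t m = 2 → T.dist t y = 1 := by
      intro t ht
      rcases hT.dist_eq_dist_add_one_of_adj t hmy with h | h
      · omega
      · have h1 := hT.dist_eq_add_of_adj k hmy h hk hy
        have h2 := dist_le_diam hne (u := t) (v := w)
        omega
    have h1 := hconn.dist_triangle (u := u) (v := y) (w := v)
    have h2 := key u hum
    have h3 := key v hvm
    rw [dist_comm] at h3
    omega
  have h1 : T.eccent m ≤ 2 := by
    rw [eccent_le_iff]
    intro w
    rw [← (hconn m w).coe_dist_eq_edist]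
    exact_mod_cast hm2 w
  have h2 : T.edist c x ≤ 2 :=
    edist_le_eccent.trans ((hc.trans_le radius_le_eccent).trans h1)
  rw [← (hconn c x).coe_dist_eq_edist] at h2
  exact_mod_cast h2

end SimpleGraph

section Height

variable {X : Type*} {T : SimpleGraph X}

/-- The structure of a tree rooted at `c` whose vertices are all at distance at most `2` from `c`,
in terms of its bipartition `P ∋ c` and `Q`: the class `Q` is the neighbourhood of the root, and
every other member of `P` hangs from exactly one member of `Q`. -/
structure IsHeightTwo (T : SimpleGraph X) (c : X) (P Q : Set X) : Prop where
  root_mem : c ∈ P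
  disjoint : Disjoint P Q
  mem_or_mem : ∀ x, x ∈ P ∨ x ∈ Q
  adj_root_iff : ∀ x, T.Adj c x ↔ x ∈ Q
  existsUnique_parent : ∀ x ∈ P, x ≠ c → ∃! y, T.Adj x y
  mem_right_of_adj : ∀ x y, x ∈ P → T.Adj x y → y ∈ Q
  mem_left_of_adj : ∀ x y, x ∈ Q → T.Adj x y → y ∈ P

lemma SimpleGraph.IsTree.isHeightTwo [Finite X] (hT : T.IsTree) (hd : T.diam = 4) {c : X}
    (hc : c ∈ T.center) {P Q : Set X} (hPQ : T.IsBipartiteWith P Q) (hcP : c ∈ P) :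
    IsHeightTwo T c P Q := by
  have hconn := hT.connected
  have hdis : ∀ x, x ∈ P → x ∈ Q → False := fun x h1 h2 =>
    Set.disjoint_left.mp hPQ.disjoint h1 h2
  have hmem : ∀ x y, x ∈ P → T.Adj x y → y ∈ Q := by
    intro x y hx hxy
    rcases hPQ.mem_of_adj hxy with h | h
    · exact h.2
    · exact (hdis x hx h.1).elim
  have hmem' : ∀ x y, x ∈ Q → T.Adj x y → y ∈ P := by
    intro x y hx hxy
    rcases hPQ.mem_of_adj hxy with h | h
    · exact (hdis x h.1 hx).elim
    · exact h.2
  have htri : ∀ x, x = c ∨ T.Adj c x ∨ (T.dist c x = 2 ∧ ∃ y, T.Adj c y ∧ T.Adj y x) := by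
    intro x
    have h2 := hT.dist_le_two_of_mem_center hd hc x
    have h : T.dist c x = 0 ∨ T.dist c x = 1 ∨ T.dist c x = 1 + 1 := by omega
    rcases h with h | h | h
    · exact Or.inl (hconn.dist_eq_zero_iff.mp h).symm
    · exact Or.inr (Or.inl (SimpleGraph.dist_eq_one_iff_adj.mp h))
    · obtain ⟨y, hy, hyx⟩ := hconn.exists_adj_dist_eq h
      exact Or.inr (Or.inr ⟨h, y, hy, SimpleGraph.dist_eq_one_iff_adj.mp hyx⟩)
  have hroot : ∀ x, T.Adj c x ↔ x ∈ Q := by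
    intro x
    refine ⟨hmem c x hcP, fun hx => ?_⟩
    rcases htri x with rfl | h | ⟨-, y, hy, hyx⟩
    · exact (hdis _ hcP hx).elim
    · exact h
    · exact (hdis x (hmem' y x (hmem c y hcP hy) hyx) hx).elim
  refine ⟨hcP, hPQ.disjoint, fun x => ?_, hroot, fun x hx hxc => ?_, hmem, hmem'⟩
  · rcases htri x with rfl | h | ⟨-, y, hy, hyx⟩
    · exact Or.inl hcP
    · exact Or.inr (hmem c x hcP h)
    · exact Or.inl (hmem' y x (hmem c y hcP hy) hyx)
  · rcases htri x with h | h | ⟨h2, y, hy, hyx⟩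
    · exact (hxc h).elim
    · exact (hdis x hx (hmem c x hcP h)).elim
    · refine ⟨y, hyx.symm, fun z hxz => ?_⟩
      have hz : T.Adj c z := (hroot z).mpr (hmem x z hx hxz)
      refine hT.eq_of_adj_of_dist_eq hxz hyx.symm (u := c) ?_ ?_
      · rw [h2, SimpleGraph.dist_eq_one_iff_adj.mpr hz]
      · rw [h2, SimpleGraph.dist_eq_one_iff_adj.mpr hy]

end Height

/-! ### Homogeneous families of enumerated edges -/

section Kernels

variable {ι W : Type*} {K : ℕ} {G H : Finset (ι → W)} {I I' : Finset ι} {e : ι → W}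

/-- Edges are enumerated by functions `ι → W`. The restriction of `e` to the positions `I` is a
*kernel* of the family `G`, of strength `K`, if for every set `Z` of at most `K` vertices some
member of `G` agrees with `e` on `I` and avoids `Z` on all other positions. This replaces large
sunflowers with that restriction as a core. -/
def IsKernel (K : ℕ) (G : Finset (ι → W)) (I : Finset ι) (e : ι → W) : Prop :=
  ∀ Z : Finset W, Z.card ≤ K → ∃ f ∈ G, (∀ i ∈ I, f i = e i) ∧ ∀ i ∉ I, f i ∉ Z

lemma IsKernel.mono (h : IsKernel K G I e) (hGH : G ⊆ H) : IsKernel K H I e := by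
  intro Z hZ
  obtain ⟨f, hf, h1, h2⟩ := h Z hZ
  exact ⟨f, hGH hf, h1, h2⟩

variable [DecidableEq ι]

/-- In a family all of whose members have kernels at `I` and at `I'`, they have kernels at
`I ∩ I'`: move the member off `Z` outside `I`, and then off `Z` outside `I'`. -/
lemma isKernel_inter (h : ∀ e ∈ G, IsKernel K G I e) (h' : ∀ e ∈ G, IsKernel K G I' e)
    (he : e ∈ G) : IsKernel K G (I ∩ I') e := by
  intro Z hZ
  obtain ⟨f, hf, h1, h2⟩ := h e he Z hZ
  obtain ⟨g, hg, h3, h4⟩ := h' f hf Z hZ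
  refine ⟨g, hg, fun i hi => ?_, fun i hi => ?_⟩
  · rw [Finset.mem_inter] at hi
    rw [h3 i hi.2, h1 i hi.1]
  · by_cases hi' : i ∈ I'
    · rw [h3 i hi']
      exact h2 i fun hiI => hi (Finset.mem_inter.mpr ⟨hiI, hi'⟩)
    · exact h4 i hi'

variable [Fintype ι] [DecidableEq W]

/-- Where no proper set of positions containing `D` gives a kernel, a member of `G` is determined
by its restriction to `D` up to boundedly many choices. -/
lemma card_filter_agree_le : ∀ (k : ℕ) (D : Finset ι), Dᶜ.card = k →
    (∀ I, D ⊆ I → I ≠ Finset.univ → ∀ e ∈ G, ¬ IsKernel K G I e) →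
    ∀ e ∈ G, (G.filter fun f => ∀ i ∈ D, f i = e i).card ≤ (Fintype.card ι * K) ^ k := by
  intro k
  induction k with
  | zero =>
    intro D hD _ e _
    rw [Finset.card_eq_zero, Finset.compl_eq_empty_iff] at hD
    rw [pow_zero, Finset.card_le_one]
    intro f hf g hg
    rw [Finset.mem_filter] at hf hg
    funext i
    rw [hf.2 i (by simp [hD]), hg.2 i (by simp [hD])]
  | succ k ih =>
    intro D hD hker e he
    have hDu : D ≠ Finset.univ := by
      rintro rfl
      simp at hD
    have hnk := hker D subset_rfl hDu e he
    simp only [IsKernel, not_forall] at hnk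
    obtain ⟨Z, hZ, hZ'⟩ := hnk
    have hsub : (G.filter fun f => ∀ i ∈ D, f i = e i) ⊆
        (Dᶜ ×ˢ Z).biUnion fun p => G.filter fun f => (∀ i ∈ D, f i = e i) ∧ f p.1 = p.2 := by
      intro f hf
      rw [Finset.mem_filter] at hf
      by_contra hcon
      refine hZ' ⟨f, hf.1, hf.2, fun i hi hfi => hcon ?_⟩
      rw [Finset.mem_biUnion]
      exact ⟨(i, f i), by simp [hi, hfi], by simpa using hf⟩
    refine (Finset.card_le_card hsub).trans ?_
    refine (Finset.card_biUnion_le_card_mul _ _ ((Fintype.card ι * K) ^ k) ?_).trans ?_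
    · rintro ⟨j, z⟩ hjz
      simp only [Finset.mem_product, Finset.mem_compl] at hjz
      rcases (G.filter fun f => (∀ i ∈ D, f i = e i) ∧ f j = z).eq_empty_or_nonempty with h0 | ⟨g, hg⟩
      · simp [h0]
      · rw [Finset.mem_filter] at hg
        refine le_trans (Finset.card_le_card ?_) (ih (insert j D) ?_ ?_ g hg.1)
        · intro f hf
          simp only [Finset.mem_filter, Finset.mem_insert] at hf ⊢
          refine ⟨hf.1, ?_⟩
          rintro i (rfl | hi)
          · rw [hf.2.2, hg.2.2]
          · rw [hf.2.1 i hi, hg.2.1 i hi]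
        · rw [Finset.card_compl] at hD ⊢
          rw [Finset.card_insert_of_notMem hjz.1]
          omega
        · intro I hI
          exact hker I ((Finset.subset_insert _ _).trans hI)
    · rw [Finset.card_product, pow_succ, mul_comm]
      gcongr
      exact Finset.card_le_univ _

/-- Where no proper set of positions containing `D` gives a kernel, the family is small. -/
lemma card_le_of_no_kernel [Fintype W] (D : Finset ι)
    (hker : ∀ I, D ⊆ I → I ≠ Finset.univ → ∀ e ∈ G, ¬ IsKernel K G I e) :
    G.card ≤ (Fintype.card ι * K) ^ Dᶜ.card * Fintype.card W ^ D.card := by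
  let res : (ι → W) → (D → W) := fun f i => f i
  refine (Finset.card_le_mul_card_image (f := res) G _ ?_).trans
    (Nat.mul_le_mul_left _ ((Finset.card_le_univ _).trans_eq ?_))
  · intro t ht
    obtain ⟨e, he, rfl⟩ := Finset.mem_image.mp ht
    refine (Finset.card_le_card ?_).trans (card_filter_agree_le _ D rfl hker e he)
    intro f hf
    rw [Finset.mem_filter] at hf ⊢
    exact ⟨hf.1, fun i hi => congrFun hf.2 ⟨i, hi⟩⟩
  · simp

/-- If no nonempty subfamily of `G` has kernels at all the sets in `J`, then `G` splits into
classes, one for each `I ∈ J`, such that in the class of `I` there are no kernels at `I`: remove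
all members agreeing on `I` with a member that is not a kernel there, and repeat. -/
lemma exists_partition_of_not_homogeneous (J : Finset (Finset ι)) (G : Finset (ι → W))
    (h : ∀ H ⊆ G, H.Nonempty → ∃ e ∈ H, ∃ I ∈ J, ¬ IsKernel K H I e) :
    ∃ φ : (ι → W) → Finset ι, (∀ f ∈ G, φ f ∈ J) ∧
      ∀ I, ∀ e ∈ G.filter (φ · = I), ¬ IsKernel K (G.filter (φ · = I)) I e := by
  induction G using Finset.strongInduction with
  | H G ih =>
    rcases G.eq_empty_or_nonempty with rfl | hne
    · exact ⟨fun _ => ∅, by simp, by simp⟩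
    obtain ⟨e, he, I, hI, hnk⟩ := h G subset_rfl hne
    have hss : G.filter (fun f => ¬ ∀ i ∈ I, f i = e i) ⊂ G := by
      rw [Finset.filter_ssubset]
      exact ⟨e, he, by simp⟩
    obtain ⟨φ, hφ, hφ'⟩ := ih _ hss fun H hH => h H (hH.trans hss.subset)
    refine ⟨fun f => if ∀ i ∈ I, f i = e i then I else φ f, fun f hf => ?_, fun I' g hg hk => ?_⟩
    · dsimp only
      split_ifs with hfe
      · exact hI
      · exact hφ f (Finset.mem_filter.mpr ⟨hf, hfe⟩)
    · by_cases hge : I' = I ∧ ∀ i ∈ I, g i = e i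
      · obtain ⟨rfl, hge⟩ := hge
        apply hnk
        intro Z hZ
        obtain ⟨f, hf, h1, h2⟩ := hk Z hZ
        exact ⟨f, (Finset.mem_filter.mp hf).1, fun i hi => (h1 i hi).trans (hge i hi), h2⟩
      · have hmem : ∀ f ∈ G.filter (fun f => (if ∀ i ∈ I, f i = e i then I else φ f) = I'),
            (∀ i ∈ I', f i = g i) →
            f ∈ (G.filter (fun f => ¬ ∀ i ∈ I, f i = e i)).filter (φ · = I') := by
          intro f hf hfg
          rw [Finset.mem_filter] at hf
          by_cases hfe : ∀ i ∈ I, f i = e i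
          · rw [if_pos hfe] at hf
            obtain rfl := hf.2
            exact (hge ⟨rfl, fun i hi => (hfg i hi).symm.trans (hfe i hi)⟩).elim
          · rw [if_neg hfe] at hf
            exact Finset.mem_filter.mpr ⟨Finset.mem_filter.mpr ⟨hf.1, hfe⟩, hf.2⟩
        refine hφ' I' g (hmem g hg fun _ _ => rfl) fun Z hZ => ?_
        obtain ⟨f, hf, h1, h2⟩ := hk Z hZ
        exact ⟨f, hmem f hf h1, h1, h2⟩

/-- A family with more than `C * n ^ m` members, where `C` depends only on `K` and `ι`, has a
nonempty homogeneous subfamily whose kernel positions cover all sets of `m` positions properly. The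
induction is on the number of sets of positions at which kernels are not excluded. -/
lemma exists_homogeneous [Fintype W] (m : ℕ) (hm : m ≤ Fintype.card ι) :
    ∀ (k : ℕ) (J : Finset (Finset ι)) (G : Finset (ι → W)), J.card = k →
      (∀ I ∉ J, I ≠ Finset.univ → ∀ e ∈ G, ¬ IsKernel K G I e) →
      (2 ^ Fintype.card ι) ^ k * (Fintype.card ι * K) ^ (Fintype.card ι - m) *
        Fintype.card W ^ m < G.card →
      ∃ H ⊆ G, H.Nonempty ∧ ∀ D : Finset ι, D.card = m →
        ∃ I, D ⊆ I ∧ I ≠ Finset.univ ∧ ∀ e ∈ H, IsKernel K H I e := by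
  intro k
  induction k with
  | zero =>
    intro J G hJ hout hcard
    rw [Finset.card_eq_zero] at hJ
    obtain ⟨D, -, hD⟩ := Finset.exists_subset_card_eq (s := (Finset.univ : Finset ι)) hm
    have := card_le_of_no_kernel (K := K) (G := G) D
      (fun I _ hI => hout I (by simp [hJ]) hI)
    rw [Finset.card_compl, hD] at this
    simp only [pow_zero, one_mul] at hcard
    omega
  | succ k ih =>
    intro J G hJ hout hcard
    by_cases hhom : ∃ H ⊆ G, H.Nonempty ∧ ∀ e ∈ H, ∀ I ∈ J, IsKernel K H I e
    · obtain ⟨H, hHG, hH, hker⟩ := hhom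
      by_cases hcov : ∀ D : Finset ι, D.card = m → ∃ I ∈ J, D ⊆ I ∧ I ≠ Finset.univ
      · refine ⟨H, hHG, hH, fun D hD => ?_⟩
        obtain ⟨I, hI, hDI, hIu⟩ := hcov D hD
        exact ⟨I, hDI, hIu, fun e he => hker e he I hI⟩
      · push Not at hcov
        obtain ⟨D, hD, hDJ⟩ := hcov
        have := card_le_of_no_kernel (K := K) (G := G) D
          (fun I hDI hI => hout I (fun hIJ => hI (hDJ I hIJ hDI)) hI)
        rw [Finset.card_compl, hD] at this
        have h1 : 1 ≤ (2 ^ Fintype.card ι) ^ (k + 1) := Nat.one_le_pow _ _ (by positivity)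
        have h2 := Nat.mul_le_mul_right
          ((Fintype.card ι * K) ^ (Fintype.card ι - m) * Fintype.card W ^ m) h1
        rw [one_mul, ← mul_assoc] at h2
        omega
    · push Not at hhom
      obtain ⟨φ, hφ, hφ'⟩ := exists_partition_of_not_homogeneous (K := K) J G hhom
      by_contra hcon
      have hle : ∀ I ∈ J, (G.filter (φ · = I)).card ≤
          (2 ^ Fintype.card ι) ^ k * (Fintype.card ι * K) ^ (Fintype.card ι - m) *
            Fintype.card W ^ m := by
        intro I hI
        by_contra! hlt
        obtain ⟨H, hH, hH'⟩ := ih (J.erase I) (G.filter (φ · = I))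
          (by rw [Finset.card_erase_of_mem hI, hJ]; rfl) (fun I' hI' hu e he hk => by
            by_cases hII : I' = I
            · subst hII
              exact hφ' I' e he hk
            · exact hout I' (fun hJ' => hI' (Finset.mem_erase.mpr ⟨hII, hJ'⟩)) hu e
                (Finset.mem_filter.mp he).1 (hk.mono (Finset.filter_subset _ _))) hlt
        exact hcon ⟨H, hH.trans (Finset.filter_subset _ _), hH'⟩
      have hsum := Finset.card_eq_sum_card_fiberwise (f := φ) (s := G) (t := J)
        (fun f hf => hφ f hf)
      have h1 := Finset.sum_le_card_nsmul J _ _ hle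
      have h2 : J.card ≤ 2 ^ Fintype.card ι := by
        simpa using Finset.card_le_univ J
      have h3 := Nat.mul_le_mul_right ((2 ^ Fintype.card ι) ^ k *
        (Fintype.card ι * K) ^ (Fintype.card ι - m) * Fintype.card W ^ m) h2
      rw [smul_eq_mul] at h1
      rw [pow_succ'] at hcard
      simp only [← mul_assoc] at h1 h3 hcard
      omega

end Kernels

/-! ### Greedy embedding of blowups -/

section Embedding

/-- Greedy choice: if each of the properties `Φ k` is satisfied by small sets avoiding any given set
of at most `K` vertices, then sets satisfying them can be chosen pairwise disjoint. -/
lemma exists_pairwise_disjoint_of_avoiding {κ W : Type*} [DecidableEq W] {K r : ℕ}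
    (t : Finset κ) (Φ : κ → Finset W → Prop) (hcard : ∀ k ∈ t, ∀ S, Φ k S → S.card ≤ r)
    (hex : ∀ k ∈ t, ∀ Z : Finset W, Z.card ≤ K → ∃ S, Φ k S ∧ Disjoint S Z)
    (Z₀ : Finset W) (hK : Z₀.card + r * t.card ≤ K) :
    ∃ S : κ → Finset W, (∀ k ∈ t, Φ k (S k) ∧ Disjoint (S k) Z₀) ∧
      ∀ k ∈ t, ∀ l ∈ t, k ≠ l → Disjoint (S k) (S l) := by
  classical
  induction t using Finset.induction_on with
  | empty => exact ⟨fun _ => ∅, by simp, by simp⟩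
  | insert k t hk ih =>
    rw [Finset.card_insert_of_notMem hk, mul_add, mul_one] at hK
    obtain ⟨S, hS, hS'⟩ := ih (fun l hl => hcard l (Finset.mem_insert_of_mem hl))
      (fun l hl => hex l (Finset.mem_insert_of_mem hl)) (by omega)
    have hU : (t.biUnion S).card ≤ t.card * r :=
      Finset.card_biUnion_le_card_mul _ _ _ fun l hl =>
        hcard l (Finset.mem_insert_of_mem hl) _ (hS l hl).1
    obtain ⟨S₁, hS₁, hd⟩ := hex k (Finset.mem_insert_self _ _) (Z₀ ∪ t.biUnion S) (by
      have := Finset.card_union_le Z₀ (t.biUnion S)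
      rw [mul_comm] at hU
      omega)
    rw [Finset.disjoint_union_right, Finset.disjoint_biUnion_right] at hd
    have hne : ∀ l ∈ t, l ≠ k := fun l hl h => hk (h ▸ hl)
    refine ⟨Function.update S k S₁, fun l hl => ?_, fun l hl l' hl' hll => ?_⟩
    · rcases Finset.mem_insert.mp hl with rfl | hl
      · rw [Function.update_self]
        exact ⟨hS₁, hd.1⟩
      · rw [Function.update_of_ne (hne l hl)]
        exact hS l hl
    · rcases Finset.mem_insert.mp hl with rfl | h <;> rcases Finset.mem_insert.mp hl' with rfl | h'
      · exact (hll rfl).elim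
      · rw [Function.update_self, Function.update_of_ne (hne l' h')]
        exact hd.2 l' h'
      · rw [Function.update_self, Function.update_of_ne (hne l h)]
        exact (hd.2 l h).symm
      · rw [Function.update_of_ne (hne l h), Function.update_of_ne (hne l' h')]
        exact hS' l h l' h' hll

variable {W : Type*} [DecidableEq W]

/-- A set `B` of vertices is *rich* in `H` if for every set `Z` of at most `K` vertices it lies in
an edge of `H` that avoids `Z` outside `B`; so its link contains large matchings. -/
def IsRich (K : ℕ) (H : Finset (Finset W)) (B : Finset W) : Prop :=
  ∀ Z : Finset W, Z.card ≤ K → ∃ e ∈ H, B ⊆ e ∧ Disjoint (e \ B) Z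

/-- The pair of a vertex set `A` and a vertex `x ∉ A` is *extendable* in `H` if for every set `Z` of
at most `K` vertices some edge of `H` contains `A` and `x`, avoids `Z` on its other vertices, and
leaves a rich set when `A` is removed. -/
def IsExtendable (K : ℕ) (H : Finset (Finset W)) (A : Finset W) (x : W) : Prop :=
  x ∉ A ∧ ∀ Z : Finset W, Z.card ≤ K →
    ∃ f ∈ H, insert x A ⊆ f ∧ Disjoint (f \ insert x A) Z ∧ IsRich K H (f \ A)

variable {X : Type*} [Fintype X] {T : SimpleGraph X} {c : X} {P Q : Set X}
  {H : Finset (Finset W)} {a b r K : ℕ} {A : Finset W}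

/-- A vertex map into pairwise disjoint sets of the right sizes whose unions along the edges of `T`
belong to `H` is a blowup contained in `H`. -/
lemma containsBlowup_of_map (F : X → Finset W) (hF : ∀ x y, x ≠ y → Disjoint (F x) (F y))
    (hP : ∀ x ∈ P, (F x).card = a) (hQ : ∀ y ∈ Q, (F y).card = b)
    (hH : ∀ x ∈ P, ∀ y ∈ Q, T.Adj x y → F x ∪ F y ∈ H) : ContainsBlowup H T P Q a b := by
  classical
  refine ⟨((Finset.univ : Finset (X × X)).filter fun p => p.1 ∈ P ∧ p.2 ∈ Q ∧ T.Adj p.1 p.2).image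
    fun p => F p.1 ∪ F p.2, ?_, F, hF, hP, hQ, ?_⟩
  · intro e he
    simp only [Finset.mem_image, Finset.mem_filter, Finset.mem_univ, true_and] at he
    obtain ⟨p, ⟨h1, h2, h3⟩, rfl⟩ := he
    exact hH _ h1 _ h2 h3
  · intro e
    simp only [Finset.mem_image, Finset.mem_filter, Finset.mem_univ, true_and, Prod.exists]
    constructor
    · rintro ⟨x, y, ⟨h1, h2, h3⟩, rfl⟩
      exact ⟨x, h1, y, h2, h3, rfl⟩
    · rintro ⟨x, h1, y, h2, h3, rfl⟩
      exact ⟨x, y, ⟨h1, h2, h3⟩, rfl⟩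

/-- Once the sets of the root and of its neighbours are placed, the remaining ones are found
greedily in the links of the rich sets. -/
lemma containsBlowup_of_rich (hT : IsHeightTwo T c P Q)
    (hH : (H : Set (Finset W)).Sized r) (hab : a + b = r)
    (hK : r * (2 * Fintype.card X + 1) ≤ K) (hA : A.card = a) (B : X → Finset W)
    (hB : ∀ y ∈ Q, (B y).card = b) (hAB : ∀ y ∈ Q, Disjoint A (B y))
    (hBB : ∀ y ∈ Q, ∀ y' ∈ Q, y ≠ y' → Disjoint (B y) (B y'))
    (hmem : ∀ y ∈ Q, A ∪ B y ∈ H) (hrich : ∀ y ∈ Q, IsRich K H (B y)) :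
    ContainsBlowup H T P Q a b := by
  classical
  let tP : Finset X := Finset.univ.filter fun x => x ∈ P ∧ x ≠ c
  let tQ : Finset X := Finset.univ.filter fun y => y ∈ Q
  have hpar : ∀ x, ∃ y, x ∈ tP → T.Adj x y ∧ ∀ z, T.Adj x z → z = y := by
    intro x
    by_cases hx : x ∈ tP
    · simp only [tP, Finset.mem_filter, Finset.mem_univ, true_and] at hx
      obtain ⟨y, hy⟩ := hT.existsUnique_parent x hx.1 hx.2
      exact ⟨y, fun _ => hy⟩
    · exact ⟨x, fun h => (hx h).elim⟩
  choose par hpar using hpar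
  have hparQ : ∀ x ∈ tP, par x ∈ Q := fun x hx =>
    hT.mem_right_of_adj x _ (Finset.mem_filter.mp hx).2.1 (hpar x hx).1
  have hU : (tQ.biUnion B).card ≤ Fintype.card X * b :=
    (Finset.card_biUnion_le_card_mul _ _ b fun y hy =>
      (hB y (Finset.mem_filter.mp hy).2).le).trans
      (Nat.mul_le_mul_right _ (Finset.card_le_univ _))
  obtain ⟨S, hS, hSS⟩ := exists_pairwise_disjoint_of_avoiding (K := K) (r := r) tP
    (fun x S => S.card = a ∧ S ∪ B (par x) ∈ H)
    (fun _ _ S hS => by rw [hS.1]; omega) (by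
      intro x hx Z hZ
      obtain ⟨e, he, hBe, hd⟩ := hrich _ (hparQ x hx) Z hZ
      refine ⟨e \ B (par x), ⟨?_, ?_⟩, hd⟩
      · rw [Finset.card_sdiff_of_subset hBe, hB _ (hparQ x hx), hH he]
        omega
      · rwa [Finset.sdiff_union_of_subset hBe]) (A ∪ tQ.biUnion B) (by
      have h1 := Finset.card_union_le A (tQ.biUnion B)
      have h2 : Fintype.card X * b ≤ r * Fintype.card X := by
        rw [mul_comm]
        exact Nat.mul_le_mul_right _ (by omega)
      have h3 : r * tP.card ≤ r * Fintype.card X :=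
        Nat.mul_le_mul_left _ (Finset.card_le_univ _)
      have h4 : r * (2 * Fintype.card X + 1) = r * Fintype.card X + r * Fintype.card X + r := by
        ring
      omega)
  have hSA : ∀ x ∈ tP, Disjoint (S x) A := fun x hx =>
    (Finset.disjoint_union_right.mp (hS x hx).2).1
  have hSB : ∀ x ∈ tP, ∀ y ∈ Q, Disjoint (S x) (B y) := fun x hx y hy =>
    (Finset.disjoint_biUnion_right _ _ _).mp (Finset.disjoint_union_right.mp (hS x hx).2).2 y
      (by simpa [tQ] using hy)
  have hcQ : c ∉ Q := fun h => Set.disjoint_left.mp hT.disjoint hT.root_mem h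
  have hcases : ∀ x, x = c ∨ x ∈ Q ∨ x ∈ tP := by
    intro x
    rcases hT.mem_or_mem x with h | h
    · by_cases hxc : x = c
      · exact Or.inl hxc
      · exact Or.inr (Or.inr (by simp [tP, h, hxc]))
    · exact Or.inr (Or.inl h)
  let F : X → Finset W := fun x => if x = c then A else if x ∈ Q then B x else S x
  have hFc : F c = A := by simp [F]
  have hFQ : ∀ y ∈ Q, F y = B y := by
    intro y hy
    have : y ≠ c := fun h => hcQ (h ▸ hy)
    simp [F, this, hy]
  have hFP : ∀ x ∈ tP, F x = S x := by
    intro x hx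
    have hx' := (Finset.mem_filter.mp hx).2
    have : x ∉ Q := fun h => Set.disjoint_left.mp hT.disjoint hx'.1 h
    simp [F, this, hx'.2]
  refine containsBlowup_of_map F ?_ ?_ ?_ ?_
  · intro x y hxy
    rcases hcases x with rfl | hx | hx <;> rcases hcases y with rfl | hy | hy
    · exact (hxy rfl).elim
    · rw [hFc, hFQ y hy]; exact hAB y hy
    · rw [hFc, hFP y hy]; exact (hSA y hy).symm
    · rw [hFc, hFQ x hx]; exact (hAB x hx).symm
    · rw [hFQ x hx, hFQ y hy]; exact hBB x hx y hy hxy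
    · rw [hFQ x hx, hFP y hy]; exact (hSB y hy x hx).symm
    · rw [hFc, hFP x hx]; exact hSA x hx
    · rw [hFP x hx, hFQ y hy]; exact hSB x hx y hy
    · rw [hFP x hx, hFP y hy]; exact hSS x hx y hy hxy
  · intro x hx
    rcases hcases x with rfl | h | h
    · rw [hFc, hA]
    · exact (Set.disjoint_left.mp hT.disjoint hx h).elim
    · rw [hFP x h]; exact (hS x h).1.1
  · intro y hy
    rw [hFQ y hy, hB y hy]
  · intro x hx y hy hxy
    rw [hFQ y hy]
    rcases hcases x with rfl | h | h
    · rw [hFc]; exact hmem y hy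
    · exact (Set.disjoint_left.mp hT.disjoint hx h).elim
    · rw [hFP x h, (hpar x h).2 y hxy]; exact (hS x h).1.2

/-- The sets of the neighbours `y` of the root are found greedily as well, if they can be
completed from pairwise disjoint sets `D y` of at most one vertex. -/
lemma containsBlowup_of_core (hT : IsHeightTwo T c P Q)
    (hH : (H : Set (Finset W)).Sized r) (hab : a + b = r) (hr : 1 ≤ r)
    (hK : r * (2 * Fintype.card X + 1) ≤ K) (hA : A.card = a) (D : X → Finset W)
    (hD : ∀ y ∈ Q, (D y).card ≤ 1)
    (hDD : ∀ y ∈ Q, ∀ y' ∈ Q, y ≠ y' → Disjoint (D y) (D y'))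
    (hex : ∀ y ∈ Q, ∀ Z : Finset W, Z.card ≤ K → ∃ S, Disjoint S Z ∧ Disjoint A (D y ∪ S) ∧
      A ∪ (D y ∪ S) ∈ H ∧ IsRich K H (D y ∪ S)) :
    ContainsBlowup H T P Q a b := by
  classical
  let tQ : Finset X := Finset.univ.filter fun y => y ∈ Q
  have htQ : ∀ y, y ∈ tQ ↔ y ∈ Q := by simp [tQ]
  have hU : (tQ.biUnion D).card ≤ Fintype.card X * 1 :=
    (Finset.card_biUnion_le_card_mul _ _ 1 fun y hy => hD y ((htQ y).mp hy)).trans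
      (Nat.mul_le_mul_right _ (Finset.card_le_univ _))
  obtain ⟨S, hS, hSS⟩ := exists_pairwise_disjoint_of_avoiding (K := K) (r := r) tQ
    (fun y S => Disjoint A (D y ∪ S) ∧ A ∪ (D y ∪ S) ∈ H ∧ IsRich K H (D y ∪ S))
    (fun y _ S hS => by
      rw [← hH hS.2.1]
      exact Finset.card_le_card (Finset.subset_union_right.trans Finset.subset_union_right))
    (by
      intro y hy Z hZ
      obtain ⟨S, hS, hS'⟩ := hex y ((htQ y).mp hy) Z hZ
      exact ⟨S, hS', hS⟩) (tQ.biUnion D) (by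
      have h2 : Fintype.card X ≤ r * Fintype.card X := Nat.le_mul_of_pos_left _ hr
      have h3 : r * tQ.card ≤ r * Fintype.card X :=
        Nat.mul_le_mul_left _ (Finset.card_le_univ _)
      have h4 : r * (2 * Fintype.card X + 1) = r * Fintype.card X + r * Fintype.card X + r := by
        ring
      omega)
  have hSD : ∀ y ∈ Q, ∀ y' ∈ Q, Disjoint (S y) (D y') := fun y hy y' hy' =>
    (Finset.disjoint_biUnion_right _ _ _).mp (hS y ((htQ y).mpr hy)).2 y' ((htQ y').mpr hy')
  refine containsBlowup_of_rich hT hH hab hK hA (fun y => D y ∪ S y) ?_ ?_ ?_ ?_ ?_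
  · intro y hy
    obtain ⟨h1, h2, -⟩ := (hS y ((htQ y).mpr hy)).1
    have h3 := hH h2
    rw [Finset.card_union_of_disjoint h1] at h3
    omega
  · exact fun y hy => (hS y ((htQ y).mpr hy)).1.1
  · intro y hy y' hy' hne
    rw [Finset.disjoint_union_left, Finset.disjoint_union_right, Finset.disjoint_union_right]
    exact ⟨⟨hDD y hy y' hy' hne, (hSD y' hy' y hy).symm⟩, hSD y hy y' hy',
      hSS y ((htQ y).mpr hy) y' ((htQ y').mpr hy') hne⟩
  · exact fun y hy => (hS y ((htQ y).mpr hy)).1.2.1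
  · exact fun y hy => (hS y ((htQ y).mpr hy)).1.2.2

/-- Without a blowup, an `a`-set `A` is extendable by fewer vertices than the root has
neighbours. -/
lemma card_lt_of_isExtendable (hT : IsHeightTwo T c P Q)
    (hH : (H : Set (Finset W)).Sized r) (hab : a + b = r) (hr : 1 ≤ r)
    (hK : r * (2 * Fintype.card X + 1) ≤ K) (hno : ¬ ContainsBlowup H T P Q a b)
    (hA : A.card = a) (V : Finset W) (hV : ∀ x ∈ V, IsExtendable K H A x) :
    V.card < Q.ncard := by
  classical
  by_contra! hle
  apply hno
  obtain ⟨V', hV', hcard⟩ := Finset.exists_subset_card_eq hle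
  have hcard' : (Q.toFinset).card = V'.card := by
    rw [hcard, Set.ncard_eq_toFinset_card']
  let φ := Finset.equivOfCardEq hcard'
  let v : X → Finset W := fun y => if hy : y ∈ Q then {(φ ⟨y, Set.mem_toFinset.mpr hy⟩ : W)} else ∅
  have hv : ∀ y ∈ Q, ∃ x, v y = {x} ∧ IsExtendable K H A x := by
    intro y hy
    refine ⟨φ ⟨y, Set.mem_toFinset.mpr hy⟩, by simp [v, hy], hV _ (hV' (Subtype.prop _))⟩
  refine containsBlowup_of_core hT hH hab hr hK hA v ?_ ?_ ?_
  · intro y hy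
    obtain ⟨x, hx, -⟩ := hv y hy
    simp [hx]
  · intro y hy y' hy' hne
    simp only [v, hy, hy', dif_pos, Finset.disjoint_singleton]
    intro h
    exact hne (by simpa using φ.injective (Subtype.ext h))
  · intro y hy Z hZ
    obtain ⟨x, hx, hxA, hx'⟩ := hv y hy
    obtain ⟨f, hf, hsub, hd, hrich⟩ := hx' Z hZ
    have hfA : {x} ∪ (f \ insert x A) = f \ A := by
      ext w
      have hxf : x ∈ f := hsub (Finset.mem_insert_self _ _)
      simp only [Finset.mem_union, Finset.mem_singleton, Finset.mem_sdiff, Finset.mem_insert]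
      grind
    refine ⟨f \ insert x A, hd, ?_, ?_, ?_⟩ <;> rw [hx, hfA]
    · exact Finset.disjoint_sdiff
    · rwa [Finset.union_sdiff_of_subset ((Finset.subset_insert _ _).trans hsub)]
    · exact hrich

end Embedding

/-! ### Families of position sets closed under union -/

section UnionClosed

variable {ι : Type*} [DecidableEq ι] {U : Set (Finset ι)}

lemma biUnion_mem_of_union_closed {κ : Type*} (hempty : ∅ ∈ U)
    (hunion : ∀ Y ∈ U, ∀ Y' ∈ U, Y ∪ Y' ∈ U) (s : Finset κ) (V : κ → Finset ι)
    (hV : ∀ i ∈ s, V i ∈ U) : s.biUnion V ∈ U := by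
  rw [← Finset.sup_eq_biUnion]
  exact Finset.sup_induction hempty hunion hV

/-- A union-closed family that contains a nonempty subset of every pair contains every set that
does not meet in exactly one element the set `L` of the elements `i` with `{i} ∉ U`. -/
lemma mem_of_card_inter_ne_one (hempty : ∅ ∈ U) (hunion : ∀ Y ∈ U, ∀ Y' ∈ U, Y ∪ Y' ∈ U)
    (hpair : ∀ i j, i ≠ j → {i} ∈ U ∨ {j} ∈ U ∨ {i, j} ∈ U) {L : Finset ι}
    (hL : ∀ i, i ∈ L ↔ {i} ∉ U) {Y : Finset ι} (hY : (Y ∩ L).card ≠ 1) : Y ∈ U := by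
  have hcover : ∀ i : ι, ∃ V : Finset ι, i ∈ Y → i ∈ V ∧ V ⊆ Y ∧ V ∈ U := by
    intro i
    by_cases hi : i ∈ Y
    · by_cases hiL : i ∈ L
      · have hmem : i ∈ Y ∩ L := Finset.mem_inter.mpr ⟨hi, hiL⟩
        have h2 : 1 < (Y ∩ L).card := by
          have := Finset.card_pos.mpr ⟨i, hmem⟩
          omega
        obtain ⟨j, hj, hji⟩ := Finset.exists_mem_ne h2 i
        rw [Finset.mem_inter] at hj
        refine ⟨{i, j}, fun _ => ⟨by simp, ?_, ?_⟩⟩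
        · intro k hk
          rcases Finset.mem_insert.mp hk with rfl | hk
          · exact hi
          · rw [Finset.mem_singleton] at hk
            exact hk ▸ hj.1
        · rcases hpair i j hji.symm with h | h | h
          · exact ((hL i).mp hiL h).elim
          · exact ((hL j).mp hj.2 h).elim
          · exact h
      · rw [hL, not_not] at hiL
        exact ⟨{i}, fun _ => ⟨by simp, by simpa using hi, hiL⟩⟩
    · exact ⟨∅, fun h => (hi h).elim⟩
  choose V hV using hcover
  have : Y = Y.biUnion V := by
    ext i
    rw [Finset.mem_biUnion]
    exact ⟨fun hi => ⟨i, hi, (hV i hi).1⟩, fun ⟨j, hj, hij⟩ => (hV j hj).2.1 hij⟩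
  rw [this]
  exact biUnion_mem_of_union_closed hempty hunion Y V fun i hi => (hV i hi).2.2

variable [Fintype ι]

lemma exists_card_eq_card_inter_eq {L : Finset ι} {a t : ℕ} (ht : t ≤ L.card) (hta : t ≤ a)
    (hat : a - t ≤ Lᶜ.card) : ∃ A : Finset ι, A.card = a ∧ (A ∩ L).card = t := by
  obtain ⟨A₁, h1, h1'⟩ := Finset.exists_subset_card_eq ht
  obtain ⟨A₂, h2, h2'⟩ := Finset.exists_subset_card_eq hat
  have hd : Disjoint L A₂ := by
    rw [Finset.disjoint_left]
    exact fun i hi hi' => Finset.mem_compl.mp (h2 hi') hi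
  refine ⟨A₁ ∪ A₂, ?_, ?_⟩
  · rw [Finset.card_union_of_disjoint (Finset.disjoint_of_subset_left h1 hd)]
    omega
  · rw [Finset.union_inter_distrib_right, Finset.inter_eq_left.mpr h1,
      Finset.disjoint_iff_inter_eq_empty.mp hd.symm, Finset.union_empty, h1']

/-- Let `U` be a union-closed family that contains a nonempty subset of every pair, but no `a`-set
together with its complement. Then there are at least `r - 1` choose `a` pairs of an `a`-set `A ∈ U`
and an element `x ∉ A` such that the complement of `A` without `x` is in `U`.

With `L` as in `mem_of_card_inter_ne_one`, either `L` is a single element `x`, and `A` can be any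
`a`-set avoiding `x`, or `L` has `a + 1` elements and `A` can be `L` without any of its elements;
in the latter case `b = 1` or `a = b = 2`. -/
lemma choose_le_card_of_union_closed {a b r : ℕ} (hι : Fintype.card ι = r) (ha : 2 ≤ a)
    (hb : 1 ≤ b) (hab : a + b = r) (hempty : ∅ ∈ U) (hunion : ∀ Y ∈ U, ∀ Y' ∈ U, Y ∪ Y' ∈ U)
    (hpair : ∀ i j, i ≠ j → {i} ∈ U ∨ {j} ∈ U ∨ {i, j} ∈ U)
    (hno : ∀ A : Finset ι, A.card = a → A ∈ U → Aᶜ ∉ U) :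
    ∃ S : Finset (Finset ι × ι), (r - 1).choose a ≤ S.card ∧
      ∀ p ∈ S, p.1.card = a ∧ p.2 ∉ p.1 ∧ p.1 ∈ U ∧ p.1ᶜ.erase p.2 ∈ U := by
  classical
  let L : Finset ι := Finset.univ.filter fun i => {i} ∉ U
  have hL : ∀ i, i ∈ L ↔ {i} ∉ U := by simp [L]
  have hmem : ∀ Y : Finset ι, (Y ∩ L).card ≠ 1 → Y ∈ U := fun Y hY =>
    mem_of_card_inter_ne_one hempty hunion hpair hL hY
  have hLc : L.card + Lᶜ.card = r := by rw [Finset.card_add_card_compl, hι]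
  have harith : ∀ t, t ≤ L.card → t ≤ a → a - t ≤ Lᶜ.card → t = 1 ∨ L.card - t = 1 := by
    intro t h1 h2 h3
    obtain ⟨A, hA, hAt⟩ := exists_card_eq_card_inter_eq h1 h2 h3
    by_contra! hcon
    refine hno A hA (hmem A (by omega)) (hmem Aᶜ ?_)
    have : (Aᶜ ∩ L).card + (A ∩ L).card = L.card := by
      rw [Finset.inter_comm, ← Finset.sdiff_eq_inter_compl, Finset.inter_comm A,
        Finset.card_sdiff_add_card_inter]
    omega
  have hcompl : ∀ (A : Finset ι) (x : ι), (∀ i ∈ L, i ≠ x → i ∈ A) → Aᶜ.erase x ∈ U := by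
    intro A x h
    apply hmem
    rw [Finset.card_eq_zero.mpr]
    · simp
    · ext i
      simp only [Finset.mem_inter, Finset.mem_erase, Finset.mem_compl, Finset.notMem_empty,
        iff_false]
      rintro ⟨⟨h1, h2⟩, h3⟩
      exact h2 (h i h3 h1)
  have hk : L.card = 1 ∨ L.card = a + 1 ∧ (b = 1 ∨ a = 2 ∧ b = 2) := by
    have h0 := harith 0
    have h1 := harith L.card
    have h2 := harith a
    have h3 := harith (a - 1)
    omega
  rcases hk with hk | ⟨hk, hab'⟩
  · obtain ⟨x, hx⟩ := Finset.card_eq_one.mp hk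
    refine ⟨((Finset.univ.erase x).powersetCard a).image fun A => (A, x), ?_, ?_⟩
    · rw [Finset.card_image_of_injective _ (Prod.mk_left_injective x), Finset.card_powersetCard,
        Finset.card_erase_of_mem (Finset.mem_univ x), Finset.card_univ, hι]
    · intro p hp
      obtain ⟨A, hA, rfl⟩ := Finset.mem_image.mp hp
      rw [Finset.mem_powersetCard] at hA
      have hxA : x ∉ A := fun h => Finset.notMem_erase x _ (hA.1 h)
      refine ⟨hA.2, hxA, hmem A ?_, hcompl A x fun i hi hne => ?_⟩
      · rw [hx, Finset.inter_singleton_of_notMem hxA]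
        simp
      · exact (hne (by simpa [hx] using hi)).elim
  · refine ⟨L.image fun x => (L.erase x, x), ?_, ?_⟩
    · rw [Finset.card_image_of_injective _ fun x y h => congrArg Prod.snd h, hk]
      rcases hab' with rfl | ⟨rfl, rfl⟩
      · rw [← hab]
        simp
      · rw [← hab]
        decide
    · intro p hp
      obtain ⟨x, hx, rfl⟩ := Finset.mem_image.mp hp
      have hcard : (L.erase x).card = a := by
        rw [Finset.card_erase_of_mem hx, hk]
        rfl
      refine ⟨hcard, Finset.notMem_erase x L, hmem _ ?_, hcompl _ x fun i hi hne => ?_⟩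
      · rw [Finset.inter_eq_left.mpr (Finset.erase_subset x L), hcard]
        omega
      · exact Finset.mem_erase.mpr ⟨hne, hi⟩

end UnionClosed

/-! ### The upper bound -/

section UpperBound

variable {W : Type*} [DecidableEq W] {H : Finset (Finset W)} {a b r s K : ℕ}

lemma exists_enumeration {e : Finset W} (he : e.card = r) :
    ∃ f : Fin r → W, Function.Injective f ∧ Finset.univ.image f = e := by
  let φ := e.equivFinOfCardEq he
  refine ⟨fun i => φ.symm i, fun i j h => φ.symm.injective (Subtype.ext h), ?_⟩
  ext w
  simp only [Finset.mem_image, Finset.mem_univ, true_and]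
  constructor
  · rintro ⟨i, rfl⟩
    exact (φ.symm i).2
  · intro hw
    exact ⟨φ ⟨w, hw⟩, by simp⟩

/-- The vertex set of a kernel is rich. -/
lemma IsKernel.isRich {G : Finset (Fin r → W)} (hG : ∀ f ∈ G, Finset.univ.image f ∈ H)
    {I : Finset (Fin r)} {e : Fin r → W} (h : IsKernel K G I e) : IsRich K H (I.image e) := by
  intro Z hZ
  obtain ⟨f, hf, h1, h2⟩ := h Z hZ
  refine ⟨_, hG f hf, ?_, ?_⟩
  · intro w hw
    obtain ⟨i, hi, rfl⟩ := Finset.mem_image.mp hw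
    rw [← h1 i hi]
    exact Finset.mem_image_of_mem f (Finset.mem_univ i)
  · rw [Finset.disjoint_left]
    intro w hw
    obtain ⟨hw, hw'⟩ := Finset.mem_sdiff.mp hw
    obtain ⟨i, -, rfl⟩ := Finset.mem_image.mp hw
    refine h2 i fun hi => hw' ?_
    rw [h1 i hi]
    exact Finset.mem_image_of_mem e hi

open Classical in
/-- The pairs of an `a`-subset of `e` and a vertex of `e` that are extendable in `H`. -/
noncomputable def extendablePairs (K : ℕ) (H : Finset (Finset W)) (a : ℕ) (e : Finset W) :
    Finset (Finset W × W) :=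
  (e.powersetCard a ×ˢ e).filter fun p => IsExtendable K H p.1 p.2

lemma mem_extendablePairs {e : Finset W} {p : Finset W × W} :
    p ∈ extendablePairs K H a e ↔
      p.1 ⊆ e ∧ p.1.card = a ∧ p.2 ∈ e ∧ IsExtendable K H p.1 p.2 := by
  simp [extendablePairs, and_assoc]

variable {X : Type*} [Fintype X] {T : SimpleGraph X} {c : X} {P Q : Set X}

lemma image_compl_eq_sdiff {f : Fin r → W} (hf : Function.Injective f) (A : Finset (Fin r)) :
    Aᶜ.image f = Finset.univ.image f \ A.image f := by
  rw [Finset.compl_eq_univ_sdiff, Finset.image_sdiff _ _ hf]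

/-- Without a blowup, the edges of a homogeneous subfamily whose kernels properly cover all sets
of `r - 2` positions contain many extendable pairs. -/
lemma choose_le_card_extendablePairs (hT : IsHeightTwo T c P Q)
    (hH : (H : Set (Finset W)).Sized r) (ha : 2 ≤ a) (hb : 1 ≤ b) (hab : a + b = r)
    (hK : r * (2 * Fintype.card X + 1) ≤ K) (hno : ¬ ContainsBlowup H T P Q a b)
    {G : Finset (Fin r → W)} (hGH : ∀ f ∈ G, Finset.univ.image f ∈ H)
    (hinj : ∀ f ∈ G, Function.Injective f)
    (hcov : ∀ D : Finset (Fin r), D.card = r - 2 →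
      ∃ I, D ⊆ I ∧ I ≠ Finset.univ ∧ ∀ e ∈ G, IsKernel K G I e) {e : Fin r → W} (he : e ∈ G) :
    (r - 1).choose a ≤ (extendablePairs K H a (Finset.univ.image e)).card := by
  let U : Set (Finset (Fin r)) := {Y | ∀ f ∈ G, IsKernel K G Yᶜ f}
  have hagree : ∀ {f : Fin r → W} {A : Finset (Fin r)}, (∀ i ∈ A, f i = e i) →
      A.image f = A.image e := fun h => Finset.image_congr h
  obtain ⟨S, hS, hS'⟩ := choose_le_card_of_union_closed (U := U) (Fintype.card_fin r) ha hb hab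
    (fun f hf Z _ => ⟨f, hf, fun _ _ => rfl, by simp⟩)
    (fun Y hY Y' hY' f hf => by
      rw [Finset.compl_union]
      exact isKernel_inter hY hY' hf)
    (fun i j hij => by
      obtain ⟨I, hDI, hIu, hI⟩ := hcov {i, j}ᶜ (by
        rw [Finset.card_compl, Finset.card_pair hij, Fintype.card_fin])
      have hIU : Iᶜ ∈ U := by
        intro f hf
        rw [compl_compl]
        exact hI f hf
      have hsub : Iᶜ ⊆ {i, j} := compl_le_iff_compl_le.mp hDI
      have hne : Iᶜ ≠ ∅ := fun h => hIu (Finset.compl_eq_empty_iff _ |>.mp h)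
      rw [← Finset.mem_powerset, Finset.powerset_insert, Finset.mem_union] at hsub
      simp only [Finset.mem_image, Finset.mem_powerset, Finset.subset_singleton_iff] at hsub
      rcases hsub with (h | h) | ⟨J, rfl | rfl, h⟩
      · exact (hne h).elim
      · exact Or.inr (Or.inl (h ▸ hIU))
      · exact Or.inl (by rw [← insert_empty_eq, h]; exact hIU)
      · exact Or.inr (Or.inr (h ▸ hIU)))
    (fun A hA hAU hAU' => by
      apply hno
      refine containsBlowup_of_core hT hH hab (by omega) hK (A := A.image e)
        (by rw [Finset.card_image_of_injective _ (hinj e he), hA]) (fun _ => ∅) (by simp)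
        (by simp) ?_
      intro y _ Z hZ
      have hker := hAU' e he
      rw [compl_compl] at hker
      obtain ⟨f, hf, h1, h2⟩ := hker Z hZ
      refine ⟨Aᶜ.image f, ?_, ?_, ?_, ?_⟩
      · rw [Finset.disjoint_left]
        intro w hw
        obtain ⟨i, hi, rfl⟩ := Finset.mem_image.mp hw
        exact h2 i (Finset.mem_compl.mp hi)
      · rw [Finset.empty_union, ← hagree h1, image_compl_eq_sdiff (hinj f hf)]
        exact Finset.disjoint_sdiff
      · rw [Finset.empty_union, ← hagree h1, ← Finset.image_union, Finset.union_compl]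
        exact hGH f hf
      · rw [Finset.empty_union]
        exact (hAU f hf).isRich hGH)
  refine hS.trans (Finset.card_le_card_of_injOn (fun p => (p.1.image e, e p.2)) ?_ ?_)
  · rintro ⟨A, x⟩ hp
    obtain ⟨hA, hx, hAU, hxU⟩ := hS' _ hp
    dsimp only at hA hx hAU hxU
    rw [Finset.mem_coe, mem_extendablePairs]
    refine ⟨Finset.image_subset_image (Finset.subset_univ _),
      by rw [Finset.card_image_of_injective _ (hinj e he), hA],
      Finset.mem_image_of_mem e (Finset.mem_univ x), ?_, fun Z hZ => ?_⟩
    · rw [(hinj e he).mem_finset_image]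
      exact hx
    · have hins : (Aᶜ.erase x)ᶜ = insert x A := by
        rw [Finset.compl_erase, compl_compl]
      have hker := hxU e he
      rw [hins] at hker
      obtain ⟨f, hf, h1, h2⟩ := hker Z hZ
      have hins' : insert (e x) (A.image e) = (insert x A).image f := by
        rw [hagree h1, Finset.image_insert]
      refine ⟨_, hGH f hf, ?_, ?_, ?_⟩
      · rw [hins']
        exact Finset.image_subset_image (Finset.subset_univ _)
      · rw [hins', ← image_compl_eq_sdiff (hinj f hf), Finset.disjoint_left]
        intro w hw
        obtain ⟨i, hi, rfl⟩ := Finset.mem_image.mp hw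
        exact h2 i (Finset.mem_compl.mp hi)
      · dsimp only
        rw [← hagree fun i hi => h1 i (Finset.mem_insert_of_mem hi),
          ← image_compl_eq_sdiff (hinj f hf)]
        exact (hAU f hf).isRich hGH
  · rintro ⟨A, x⟩ _ ⟨A', x'⟩ _ h
    rw [Prod.mk.injEq] at h ⊢
    exact ⟨Finset.image_injective (hinj e he) h.1, hinj e he h.2⟩

/-- Without a blowup, all but `O(n ^ (r - 2))` edges contain many extendable pairs. -/
lemma card_filter_extendablePairs_lt_le [Fintype W] (hT : IsHeightTwo T c P Q)
    (hH : (H : Set (Finset W)).Sized r) (ha : 2 ≤ a) (hb : 1 ≤ b) (hab : a + b = r)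
    (hK : r * (2 * Fintype.card X + 1) ≤ K) (hno : ¬ ContainsBlowup H T P Q a b) :
    (H.filter fun e => (extendablePairs K H a e).card < (r - 1).choose a).card ≤
      (2 ^ r) ^ (2 ^ r) * (r * K) ^ 2 * Fintype.card W ^ (r - 2) := by
  set G := H.filter fun e => (extendablePairs K H a e).card < (r - 1).choose a with hG
  by_contra! hlt
  have hGH : G ⊆ H := Finset.filter_subset _ _
  have henum : ∀ e : G, ∃ f : Fin r → W, Function.Injective f ∧ Finset.univ.image f = e.1 :=
    fun e => exists_enumeration (hH (hGH e.2))
  choose φ hφ hφ' using henum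
  have hφinj : Function.Injective φ := fun e e' h => Subtype.ext (by rw [← hφ', h, hφ'])
  let G' : Finset (Fin r → W) := Finset.univ.image φ
  have hcard : G'.card = G.card := by
    rw [Finset.card_image_of_injective _ hφinj, Finset.card_univ, Fintype.card_coe]
  have hG' : ∀ f ∈ G', Function.Injective f ∧ Finset.univ.image f ∈ G := by
    intro f hf
    obtain ⟨e, -, rfl⟩ := Finset.mem_image.mp hf
    exact ⟨hφ e, hφ' e ▸ e.2⟩
  obtain ⟨F, hF, ⟨e, he⟩, hcov⟩ := exists_homogeneous (ι := Fin r) (K := K) (r - 2)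
    (by rw [Fintype.card_fin]; omega) (2 ^ r) Finset.univ G' (by simp) (by simp) (by
      rw [Fintype.card_fin, hcard, Nat.sub_sub_self (by omega)]
      exact hlt)
  have h1 := choose_le_card_extendablePairs hT hH ha hb hab hK hno
    (fun f hf => hGH (hG' f (hF hf)).2) (fun f hf => (hG' f (hF hf)).1) hcov he
  have h2 := (Finset.mem_filter.mp (hG' e (hF he)).2).2
  omega

/-- Double counting of the triples `(e \ {x}, A, x)`, where `(A, x)` is an extendable pair
contained in the edge `e`. -/
lemma card_le_of_choose_le_card_extendablePairs [Fintype W] {G : Finset (Finset W)}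
    (hG : (G : Set (Finset W)).Sized r) (har : a ≤ r - 1)
    (hmany : ∀ e ∈ G, (r - 1).choose a ≤ (extendablePairs K H a e).card)
    (hfew : ∀ A V : Finset W, A.card = a → (∀ x ∈ V, IsExtendable K H A x) → V.card ≤ s) :
    G.card ≤ s * (Fintype.card W).choose (r - 1) := by
  classical
  let E : Finset (Σ _ : Finset W, Finset W × W) := G.sigma fun e => extendablePairs K H a e
  let R : Finset (Σ _ : Finset W, Σ _ : Finset W, W) :=
    (Finset.univ.powersetCard (r - 1)).sigma fun B => (B.powersetCard a).sigma fun A =>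
      Finset.univ.filter fun x => IsExtendable K H A x
  have hle : E.card ≤ R.card := by
    refine Finset.card_le_card_of_injOn (fun t => ⟨t.1.erase t.2.2, t.2.1, t.2.2⟩) ?_ ?_
    · rintro ⟨e, A, x⟩ ht
      simp only [E, Finset.coe_sigma, Set.mem_sigma_iff, Finset.mem_coe, mem_extendablePairs] at ht
      obtain ⟨he, hAe, hA, hx, hext⟩ := ht
      simp only [R, Finset.coe_sigma, Set.mem_sigma_iff, Finset.mem_coe, Finset.mem_powersetCard,
        Finset.subset_univ, true_and, Finset.mem_filter, Finset.mem_univ]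
      refine ⟨by rw [Finset.card_erase_of_mem hx, hG he], ⟨?_, hA⟩, hext⟩
      exact fun w hw => Finset.mem_erase.mpr ⟨fun h => hext.1 (h ▸ hw), hAe hw⟩
    · rintro ⟨e, A, x⟩ ht ⟨e', A', x'⟩ ht' h
      simp only [E, Finset.coe_sigma, Set.mem_sigma_iff, Finset.mem_coe, mem_extendablePairs]
        at ht ht'
      simp only [Sigma.mk.injEq, heq_eq_eq] at h
      obtain ⟨h1, rfl, rfl⟩ := h
      have : e = e' := by
        rw [← Finset.insert_erase ht.2.2.2.1, h1, Finset.insert_erase ht'.2.2.2.1]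
      rw [this]
  have hE : G.card * (r - 1).choose a ≤ E.card := by
    rw [Finset.card_sigma, ← smul_eq_mul]
    exact Finset.card_nsmul_le_sum _ _ _ hmany
  have hR : R.card ≤ (Fintype.card W).choose (r - 1) * ((r - 1).choose a * s) := by
    rw [Finset.card_sigma]
    refine (Finset.sum_le_card_nsmul _ _ ((r - 1).choose a * s) fun B hB => ?_).trans_eq (by
      rw [Finset.card_powersetCard, Finset.card_univ, smul_eq_mul])
    rw [Finset.card_sigma]
    refine (Finset.sum_le_card_nsmul _ _ s fun A hA => ?_).trans_eq (by
      rw [Finset.card_powersetCard, (Finset.mem_powersetCard.mp hB).2, smul_eq_mul])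
    exact hfew A _ (Finset.mem_powersetCard.mp hA).2 fun x hx => (Finset.mem_filter.mp hx).2
  have hpos : 0 < (r - 1).choose a := Nat.choose_pos har
  refine Nat.le_of_mul_le_mul_right ((hE.trans (hle.trans hR)).trans_eq ?_) hpos
  ring

/-- An `r`-graph without an `(a, b)`-blowup of a tree of height two has at most
`(s - 1) * n.choose (r - 1) + O(n ^ (r - 2))` edges, where `s` is the degree of the root. -/
lemma card_le_of_not_containsBlowup [Fintype W] (hT : IsHeightTwo T c P Q)
    (hH : (H : Set (Finset W)).Sized r) (ha : 2 ≤ a) (hb : 1 ≤ b) (hab : a + b = r)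
    (hno : ¬ ContainsBlowup H T P Q a b) :
    H.card ≤ (Q.ncard - 1) * (Fintype.card W).choose (r - 1) +
      (2 ^ r) ^ (2 ^ r) * (r * (r * (2 * Fintype.card X + 1))) ^ 2 *
        Fintype.card W ^ (r - 2) := by
  set K := r * (2 * Fintype.card X + 1)
  rw [← Finset.card_filter_add_card_filter_not
    (fun e => (extendablePairs K H a e).card < (r - 1).choose a), add_comm]
  refine add_le_add ?_ (card_filter_extendablePairs_lt_le hT hH ha hb hab le_rfl hno)
  refine card_le_of_choose_le_card_extendablePairs (K := K) (H := H) (a := a)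
    (fun e he => hH (Finset.mem_filter.mp he).1) (by omega)
    (fun e he => not_lt.mp (Finset.mem_filter.mp he).2) fun A V hA hV => ?_
  have := card_lt_of_isExtendable hT hH hab (by omega) le_rfl hno hA V hV
  omega

end UpperBound

/-! ### Constructions without blowups -/

section LowerBound

variable {W : Type*} [DecidableEq W]

lemma card_le_of_pairwise_disjoint_of_nonempty_inter {κ : Type*} (t : Finset κ) (g : κ → Finset W)
    (S : Finset W) (hg : ∀ k ∈ t, ∀ l ∈ t, k ≠ l → Disjoint (g k) (g l))
    (hS : ∀ k ∈ t, (g k ∩ S).Nonempty) : t.card ≤ S.card := by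
  refine (Finset.card_le_card_biUnion (f := fun k => g k ∩ S) (fun k hk l hl hkl => ?_) hS).trans
    (Finset.card_le_card (Finset.biUnion_subset.mpr fun _ _ => Finset.inter_subset_right))
  exact Finset.disjoint_of_subset_left Finset.inter_subset_left
    (Finset.disjoint_of_subset_right Finset.inter_subset_left (hg k hk l hl hkl))

variable {X : Type*} [Fintype X] {T : SimpleGraph X} {c : X} {P Q : Set X} {a b : ℕ}

/-- A tree of height two in which at most one neighbour of the root is a leaf has a matching that
covers the neighbours of the root, so its blowups cannot be covered by fewer vertices. -/
lemma not_containsBlowup_of_inter_nonempty [DecidableRel T.Adj] (hT : IsHeightTwo T c P Q)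
    (hleaf : {v : X | T.Adj c v ∧ T.degree v = 1}.ncard ≤ 1) {S : Finset W}
    (hS : S.card < Q.ncard) {H : Finset (Finset W)} (hH : ∀ e ∈ H, (e ∩ S).Nonempty) :
    ¬ ContainsBlowup H T P Q a b := by
  classical
  rintro ⟨B, hBH, F, hF, -, -, hB⟩
  have hmatch : ∀ y ∈ Q, ∃ x ∈ P, T.Adj x y ∧ (x = c → T.degree y = 1) := by
    intro y hy
    have hcy := (hT.adj_root_iff y).mpr hy
    by_cases hd : T.degree y = 1
    · exact ⟨c, hT.root_mem, hcy, fun _ => hd⟩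
    · have hpos : 0 < T.degree y := (T.degree_pos_iff_exists_adj y).mpr ⟨c, hcy.symm⟩
      have h2 : 1 < (T.neighborFinset y).card := by
        rw [T.card_neighborFinset_eq_degree]
        omega
      obtain ⟨x, hx, hxc⟩ := Finset.exists_mem_ne h2 c
      rw [SimpleGraph.mem_neighborFinset] at hx
      exact ⟨x, hT.mem_left_of_adj y x hy hx, hx.symm, fun h => (hxc h).elim⟩
  choose! m hmP hmadj hmc using hmatch
  have hinj : ∀ y ∈ Q, ∀ y' ∈ Q, m y = m y' → y = y' := by
    intro y hy y' hy' h
    by_cases hc : m y = c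
    · refine (Set.ncard_le_one_iff (Set.toFinite _)).mp hleaf ?_ ?_
      · exact ⟨(hT.adj_root_iff y).mpr hy, hmc y hy hc⟩
      · exact ⟨(hT.adj_root_iff y').mpr hy', hmc y' hy' (h ▸ hc)⟩
    · exact (hT.existsUnique_parent _ (hmP y hy) hc).unique (hmadj y hy) (h ▸ hmadj y' hy')
  have hne : ∀ y ∈ Q, ∀ y' ∈ Q, m y ≠ y' := fun y hy y' hy' h =>
    Set.disjoint_left.mp hT.disjoint (hmP y hy) (h ▸ hy')
  refine absurd ?_ (not_le.mpr hS)
  rw [Set.ncard_eq_toFinset_card']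
  refine card_le_of_pairwise_disjoint_of_nonempty_inter _ (fun y => F (m y) ∪ F y) S ?_ ?_
  · intro y hy y' hy' hyy
    rw [Set.mem_toFinset] at hy hy'
    rw [Finset.disjoint_union_left, Finset.disjoint_union_right, Finset.disjoint_union_right]
    exact ⟨⟨hF _ _ fun h => hyy (hinj y hy y' hy' h), hF _ _ (hne y hy y' hy')⟩,
      hF _ _ (hne y' hy' y hy).symm, hF _ _ hyy⟩
  · intro y hy
    rw [Set.mem_toFinset] at hy
    exact hH _ (hBH ((hB _).mpr ⟨m y, hmP y hy, y, hy, hmadj y hy, rfl⟩))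

/-- If all edges meet `S` in exactly one vertex, then the vertices of `T` whose sets meet `S` form
one of the two classes of `T`. -/
lemma not_containsBlowup_of_card_inter_eq_one (hT : IsHeightTwo T c P Q) {S : Finset W}
    (hQ : S.card < Q.ncard) (hP : S.card < P.ncard) {H : Finset (Finset W)}
    (hH : ∀ e ∈ H, (e ∩ S).card = 1) : ¬ ContainsBlowup H T P Q a b := by
  classical
  rintro ⟨B, hBH, F, hF, -, -, hB⟩
  have hadj : ∀ x ∈ P, ∀ y ∈ Q, T.Adj x y → (F x ∩ S).card + (F y ∩ S).card = 1 := by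
    intro x hx y hy hxy
    have h := hH _ (hBH ((hB _).mpr ⟨x, hx, y, hy, hxy, rfl⟩))
    rwa [Finset.union_inter_distrib_right, Finset.card_union_of_disjoint] at h
    exact Finset.disjoint_of_subset_left Finset.inter_subset_left
      (Finset.disjoint_of_subset_right Finset.inter_subset_left (hF x y hxy.ne))
  have hcy : ∀ y ∈ Q, (F c ∩ S).card + (F y ∩ S).card = 1 := fun y hy =>
    hadj c hT.root_mem y hy ((hT.adj_root_iff y).mpr hy)
  have hclass : ∀ V : Set X, (∀ x ∈ V, (F x ∩ S).card ≠ 0) → V.ncard ≤ S.card := by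
    intro V hV
    rw [Set.ncard_eq_toFinset_card']
    refine card_le_of_pairwise_disjoint_of_nonempty_inter _ F S (fun x _ y _ => hF x y) ?_
    intro x hx
    exact Finset.card_ne_zero.mp (hV x (Set.mem_toFinset.mp hx))
  by_cases hc : (F c ∩ S).card = 0
  · have := hclass Q fun y hy => by
      have := hcy y hy
      omega
    omega
  · have := hclass P fun x hx => by
      by_cases hxc : x = c
      · rwa [hxc]
      · obtain ⟨y, hxy, -⟩ := hT.existsUnique_parent x hx hxc
        have hy := hT.mem_right_of_adj x y hx hxy
        have h1 := hcy y hy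
        have h2 := hadj x hx y hy hxy
        omega
    omega

lemma card_mul_choose_le_card_filter [Fintype W] (S : Finset W) (j : ℕ) :
    S.card * (Fintype.card W - S.card).choose j ≤
      (((Finset.univ : Finset W).powersetCard (j + 1)).filter fun e => (e ∩ S).card = 1).card := by
  rw [← Finset.card_compl, ← Finset.card_powersetCard, ← Finset.card_product]
  have hnot : ∀ {x : W} {R : Finset W}, x ∈ S → R ⊆ Sᶜ → x ∉ R := fun hx hR hxR =>
    Finset.mem_compl.mp (hR hxR) hx
  have hinter : ∀ {x : W} {R : Finset W}, x ∈ S → R ⊆ Sᶜ → insert x R ∩ S = {x} := by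
    intro x R hx hR
    rw [Finset.insert_inter_of_mem hx, Finset.disjoint_iff_inter_eq_empty.mp, insert_empty_eq]
    exact Finset.disjoint_left.mpr fun w hw => Finset.mem_compl.mp (hR hw)
  refine Finset.card_le_card_of_injOn (fun p => insert p.1 p.2) ?_ ?_
  · rintro ⟨x, R⟩ h
    simp only [Finset.coe_product, Set.mem_prod, Finset.mem_coe, Finset.mem_powersetCard] at h
    obtain ⟨hx, hR, hRj⟩ := h
    rw [Finset.mem_coe, Finset.mem_filter, Finset.mem_powersetCard]
    refine ⟨⟨Finset.subset_univ _, ?_⟩, ?_⟩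
    · rw [Finset.card_insert_of_notMem (hnot hx hR), hRj]
    · rw [hinter hx hR, Finset.card_singleton]
  · rintro ⟨x, R⟩ h ⟨x', R'⟩ h' heq
    simp only [Finset.coe_product, Set.mem_prod, Finset.mem_coe, Finset.mem_powersetCard] at h h'
    dsimp only at heq
    have hx : x = x' := by
      rw [← Finset.singleton_inj, ← hinter h.1 h.2.1, heq, hinter h'.1 h'.2.1]
    subst hx
    rw [← Finset.erase_insert (hnot h.1 h.2.1), heq, Finset.erase_insert (hnot h.1 h'.2.1)]

lemma choose_le_choose_sub_add (n m : ℕ) : ∀ k ≤ n,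
    n.choose (m + 1) ≤ (n - k).choose (m + 1) + k * n.choose m := by
  intro k
  induction k with
  | zero => simp
  | succ k ih =>
    intro hk
    have h1 := ih (by omega)
    have h2 : n - k = (n - (k + 1)) + 1 := by omega
    have h3 : (n - (k + 1)).choose m ≤ n.choose m := Nat.choose_le_choose m (by omega)
    rw [h2, Nat.choose_succ_succ'] at h1
    rw [add_mul, one_mul]
    omega

/-- Removing `k` of `n` points changes `n.choose (m + 1)` by a factor tending to `1`. -/
lemma exists_forall_sub_mul_choose_le (k m : ℕ) {ε : ℝ} (hε : 0 < ε) :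
    ∃ N : ℕ, k ≤ N ∧ ∀ n, N ≤ n →
      ((k : ℝ) - ε) * (n.choose (m + 1) : ℝ) ≤ (k : ℝ) * ((n - k).choose (m + 1) : ℝ) := by
  refine ⟨k + m + ⌈(k : ℝ) ^ 2 * (m + 1) / ε⌉₊, by omega, fun n hn => ?_⟩
  have h1 : (n.choose (m + 1) : ℝ) ≤ (n - k).choose (m + 1) + k * n.choose m := by
    exact_mod_cast choose_le_choose_sub_add n m k (by omega)
  have h2 : (n.choose (m + 1) : ℝ) * (m + 1) = n.choose m * ((n - m : ℕ) : ℝ) := by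
    exact_mod_cast Nat.choose_succ_right_eq n m
  have h3 : (k : ℝ) ^ 2 * (m + 1) ≤ ε * ((n - m : ℕ) : ℝ) := by
    rw [mul_comm ε, ← div_le_iff₀ hε]
    refine (Nat.le_ceil _).trans ?_
    exact_mod_cast (by omega : ⌈(k : ℝ) ^ 2 * (m + 1) / ε⌉₊ ≤ n - m)
  have h4 : (k : ℝ) ^ 2 * n.choose m ≤ ε * n.choose (m + 1) := by
    have hm : (0 : ℝ) < m + 1 := by positivity
    refine le_of_mul_le_mul_right ?_ hm
    calc (k : ℝ) ^ 2 * n.choose m * (m + 1) = (k : ℝ) ^ 2 * (m + 1) * n.choose m := by ring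
      _ ≤ ε * ((n - m : ℕ) : ℝ) * n.choose m := by gcongr
      _ = ε * n.choose (m + 1) * (m + 1) := by rw [mul_assoc ε _ ((m : ℝ) + 1), h2]; ring
  have h5 := mul_le_mul_of_nonneg_left h1 (Nat.cast_nonneg (α := ℝ) k)
  linarith

end LowerBound

/-! ### Blowups of trees of diameter four -/

theorem theorem4 {X : Type*} [Fintype X] (T : SimpleGraph X) [DecidableRel T.Adj]
    (hT : T.IsTree) (hdiam : T.diam = 4)
    (c : X) (hc : c ∈ T.center) (s : ℕ) (hs : T.degree c = s)
    (P Q : Set X) (hPQ : T.IsBipartiteWith P Q) (hcP : c ∈ P)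
    (r : ℕ) (hr : 3 ≤ r) :
    (∃ C : ℝ, 0 < C ∧
      ∀ a b : ℕ, 2 ≤ a → 1 ≤ b → a + b = r →
      ∀ (n : ℕ) (H : Finset (Finset (Fin n))), (H : Set (Finset (Fin n))).Sized r →
        ((s : ℝ) - 1) * (n.choose (r - 1) : ℝ) + C * (n : ℝ) ^ (r - 2) < (H.card : ℝ) →
        ContainsBlowup H T P Q a b) ∧
    (2 * s ≤ Fintype.card X →
      ∀ a b : ℕ, 2 ≤ a → 1 ≤ b → a + b = r →
      ∀ ε : ℝ, 0 < ε → ∃ N : ℕ, ∀ n : ℕ, N ≤ n →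
        ∃ H : Finset (Finset (Fin n)), (H : Set (Finset (Fin n))).Sized r ∧
          ((s : ℝ) - 1 - ε) * (n.choose (r - 1) : ℝ) ≤ (H.card : ℝ) ∧
          ¬ ContainsBlowup H T P Q a b) ∧
    ({v : X | T.Adj c v ∧ T.degree v = 1}.ncard ≤ 1 →
      ∀ a b : ℕ, 2 ≤ a → 1 ≤ b → a + b = r →
      ∀ (n : ℕ) (S : Finset (Fin n)), S.card + 1 = s →
        ¬ ContainsBlowup
          (((Finset.univ : Finset (Fin n)).powersetCard r).filter fun e => (e ∩ S).Nonempty)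
          T P Q a b) := by
  have hT2 := hT.isHeightTwo hdiam hc hPQ hcP
  have hQs : Q.ncard = s := by
    have : Q = (T.neighborFinset c : Set X) := by
      ext y
      rw [Finset.mem_coe, SimpleGraph.mem_neighborFinset, hT2.adj_root_iff]
    rw [this, Set.ncard_coe_finset, T.card_neighborFinset_eq_degree, hs]
  have hs1 : 1 ≤ s := by
    have : Nontrivial X := SimpleGraph.nontrivial_of_diam_ne_zero (G := T) (by omega)
    rw [← hs]
    exact hT.connected.preconnected.degree_pos_of_nontrivial c
  have hPs : P.ncard + s = Fintype.card X := by
    rw [← hQs, ← Set.ncard_union_eq hT2.disjoint, ← Nat.card_eq_fintype_card, ← Set.ncard_univ]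
    congr 1
    exact Set.eq_univ_of_forall hT2.mem_or_mem
  have hcast : ((s - 1 : ℕ) : ℝ) = (s : ℝ) - 1 := by
    rw [Nat.cast_sub hs1, Nat.cast_one]
  refine ⟨⟨((2 ^ r) ^ (2 ^ r) * (r * (r * (2 * Fintype.card X + 1))) ^ 2 : ℕ), ?_, ?_⟩, ?_, ?_⟩
  · have : 0 < r := by omega
    exact_mod_cast by positivity
  · intro a b ha hb hab n H hH hlt
    by_contra hno
    have h := card_le_of_not_containsBlowup hT2 hH ha hb hab hno
    rw [hQs, Fintype.card_fin] at h
    have h' : (H.card : ℝ) ≤ _ := Nat.cast_le.mpr h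
    rw [Nat.cast_add, Nat.cast_mul, hcast, Nat.cast_mul, Nat.cast_pow n] at h'
    exact absurd hlt (not_lt.mpr h')
  · intro hsX a b ha hb hab ε hε
    obtain ⟨N, hkN, hN⟩ := exists_forall_sub_mul_choose_le (s - 1) (r - 2) hε
    refine ⟨N, fun n hn => ?_⟩
    obtain ⟨S, -, hS⟩ := Finset.exists_subset_card_eq (s := (Finset.univ : Finset (Fin n)))
      (n := s - 1) (by rw [Finset.card_univ, Fintype.card_fin]; omega)
    refine ⟨((Finset.univ : Finset (Fin n)).powersetCard r).filter fun e => (e ∩ S).card = 1,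
      fun e he => ?_, ?_, ?_⟩
    · exact (Finset.mem_powersetCard.mp (Finset.mem_filter.mp he).1).2
    · have h1 := hN n hn
      have h2 := card_mul_choose_le_card_filter S (r - 1)
      rw [hS, Fintype.card_fin, Nat.sub_add_cancel (by omega)] at h2
      rw [(by omega : r - 2 + 1 = r - 1), hcast] at h1
      refine h1.trans ?_
      rw [← hcast]
      exact_mod_cast h2
    · exact not_containsBlowup_of_card_inter_eq_one hT2 (by omega) (by omega)
        fun e he => (Finset.mem_filter.mp he).2
  · intro hleaf a b _ _ _ n S hS
    exact not_containsBlowup_of_inter_nonempty hT2 hleaf (by omega)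
      fun e he => (Finset.mem_filter.mp he).2
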